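/- Let $n\ge 2$ and $d\ge 1$, and consider pure states of $2n$ qudits, i.e. unit vectors $|\psi\rangle\in(\mathbb{C}^d)^{\otimes 2n}$, with vectors that differ by a global phase factor describing the same state. For a set $J$ of particles let $\rho_J=\mathrm{Tr}_{J^c}(|\psi\rangle\langle\psi|)$ be the marginal of $|\psi\rangle$ on $J$, the partial trace being taken over all particles outside $J$. For a family $\mathcal F$ of sets of particles, $|\psi\rangle$ is uniquely determined among pure states (UDP) by its marginals $\rho_J$, $J\in\mathcal F$, if every pure state $|\phi\rangle$ with the same marginals on all $J\in\mathcal F$ satisfies $|\phi\rangle=c|\psi\rangle$ for some $c\in\mathbb{C}$ with $|c|=1$. Then almost every $2n$-qudit pure state $|\psi\rangle$, with respect to the Haar (unitarily invariant) probability measure on the unit sphere of $(\mathbb{C}^d)^{\otimes 2n}$, has the following properties. It is UDP by the collection of all its $n$-body marginals $\rho_J$, $|J|=n$. In fact, any four $n$-body marginals $\rho_{A\cup B}$, $\rho_{C\cup D}$, $\rho_{A\cup C}$, $\rho_{B\cup D}$ suffice: $|\psi\rangle$ is UDP by these four marginals whenever $A,B,C,D$ are pairwise disjoint nonempty sets of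 particles whose union is the set of all $2n$ particles and $|A\cup B|=|C\cup D|=|A\cup C|=|B\cup D|=n$ (that is, whenever $AB|CD$ and $AC|BD$ are two different bipartitions of the particles into halves). -/

import Mathlib

open MeasureTheory

noncomputable section

/-- The Hilbert space `(ℂ^d)^{⊗ N}` of `N` qudits of local dimension `d`, in coordinates with
respect to the computational basis `|x₁ … x_N⟩`, `x : Fin N → Fin d`. -/
abbrev QuditSpace (N d : ℕ) : Type := EuclideanSpace ℂ (Fin N → Fin d)

/-- The density operator `|ψ⟩⟨ψ|` of a vector `ψ`, as a matrix in the computational basis. -/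
def densityMatrix {N d : ℕ} (ψ : QuditSpace N d) :
    Matrix (Fin N → Fin d) (Fin N → Fin d) ℂ :=
  Matrix.of fun x y => ψ x * star (ψ y)

/-- The computational basis index that is `x` on the parties in `J` and `z` on all others. -/
def glue {N d : ℕ} (J : Finset (Fin N)) (x : {i // i ∈ J} → Fin d)
    (z : {i // i ∉ J} → Fin d) : Fin N → Fin d :=
  fun i => if h : i ∈ J then x ⟨i, h⟩ else z ⟨i, h⟩

/-- The marginal `ρ_J`: the partial trace of `ρ` over all parties outside `J`. -/
def marginal {N d : ℕ} (J : Finset (Fin N)) (ρ : Matrix (Fin N → Fin d) (Fin N → Fin d) ℂ) :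
    Matrix ({i // i ∈ J} → Fin d) ({i // i ∈ J} → Fin d) ℂ :=
  Matrix.of fun x y => ∑ z : {i // i ∉ J} → Fin d, ρ (glue J x z) (glue J y z)

/-- A pure state of `N` qudits: a unit vector (two of which that differ by a phase factor
describe the same physical state). -/
abbrev PureState (N d : ℕ) : Type := Metric.sphere (0 : QuditSpace N d) 1

/-- `ψ` is uniquely determined among pure states by its marginals on the sets of parties in `F`:
every pure state with the same marginals equals `ψ` up to a global phase. -/
def IsUDP {N d : ℕ} (F : Set (Finset (Fin N))) (ψ : PureState N d) : Prop :=
  ∀ φ : PureState N d,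
    (∀ J ∈ F, marginal J (densityMatrix (φ : QuditSpace N d)) =
      marginal J (densityMatrix (ψ : QuditSpace N d))) →
    ∃ c : ℂ, ‖c‖ = 1 ∧ (φ : QuditSpace N d) = c • (ψ : QuditSpace N d)

/-- The Haar (unitarily invariant) probability measure on pure states: the normalised surface
measure of the unit sphere. -/
def haarState (N d : ℕ) : Measure (PureState N d) :=
  ((volume : Measure (QuditSpace N d)).toSphere Set.univ)⁻¹ •
    (volume : Measure (QuditSpace N d)).toSphere

end

/-!
A tensor `ψ` is viewed, across a bipartition of the particles, as a matrix `M` (rows: one side,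
columns: the other); then `M Mᴴ` and `Mᴴ M` are, up to transposition, the two complementary
marginals. If `φ` has the same two marginals and `M'` is its matrix, then
`M' Mᴴ M = M' M'ᴴ M' = M Mᴴ M'`, which for fixed `ψ` is a *linear* condition on `φ`
(`CutCompatible`). The four marginals of the theorem are those of two bipartitions `AB|CD` and
`AC|BD`, so `φ` solves two such linear systems. Call `ψ` *rigid* if their only common solutions are
the multiples of `ψ`; a rigid unit vector is UDP (`Rigid.isUDP`).

Rigidity is generic as soon as it holds for one nonzero tensor `ψ₀` (`ae_rigid`): after adding the
equation `φ v₀ = 0` for a coordinate with `ψ₀ v₀ ≠ 0` the linear system becomes injective at `ψ₀`,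
hence some determinant, which is a real-analytic function of `ψ`, does not vanish identically, and
the zero set of such a function is null. Rigidity does not depend on the scale of `ψ`, so the
statement passes to the unit sphere by polar coordinates (`ae_toSphere_of_ae`).

It remains to exhibit one rigid tensor (`rigid_witness`). By symmetry `|B| ≤ |A|`, so the
configurations of `A` and `D` can be indexed by `κ × ι` and those of `B` and `C` by a cyclic group
`ι`. The witness is `ψ(u, b, c, d) = [c = u.2] m(u, b) w_{u,b}(d)` with distinct weights `m > 0`,
where for fixed `c = u.2` the `w_{u,b}` form an orthonormal basis: the standard basis suitably
permuted, except for `c = 0`, where it is moved by a Householder reflection.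
* Across `AB|CD` the rows of `ψ` are orthogonal with distinct norms, so a compatible `φ` is
  `r(u, b) ψ(u, b, c, d)` for some numbers `r` (`exists_row_scaling`).
* For each `b` the vectors `w_{u,b}`, `u ∈ κ × ι`, are linearly independent
  (`frame_independent`); reading the condition across `AC|BD` in this basis shows first that
  `r(u, b)` does not depend on `b`, and then that `r u = r v` whenever the rows `u` and `v` of the
  second cut are not orthogonal. Rows with `u.2 = 0` and `v.2 ≠ 0` always overlap
  (`sum_frame_mul_neg`), so `r` is constant.
-/

noncomputable section

/-! ### Zero sets of analytic functions -/

theorem ae_ne_zero_of_analytic_real {f : ℝ → ℂ} (hf : AnalyticOnNhd ℝ f Set.univ) {t₀ : ℝ}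
    (h₀ : f t₀ ≠ 0) : ∀ᵐ t, f t ≠ 0 := by
  have h : ∀ᶠ t in Filter.codiscreteWithin (Set.univ : Set ℝ), f t ≠ 0 :=
    (hf.eqOn_zero_or_eventually_ne_zero_of_preconnected isPreconnected_univ).resolve_left
      fun h => h₀ (h (Set.mem_univ t₀))
  have := ae_restrict_le_codiscreteWithin (μ := volume) MeasurableSet.univ h
  rwa [Measure.restrict_univ] at this

/-- A real-analytic function on a finite-dimensional space that is nonzero at `x₀` is nonzero almost
everywhere: its restriction to each ray from `x₀` has a null zero set, and polar coordinates about
`x₀` give the claim. -/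
theorem ae_ne_zero_of_analytic {E : Type*} [NormedAddCommGroup E] [NormedSpace ℝ E]
    [FiniteDimensional ℝ E] [MeasurableSpace E] [BorelSpace E] (μ : Measure E)
    [μ.IsAddHaarMeasure] {F : E → ℂ} (hF : AnalyticOnNhd ℝ F Set.univ) {x₀ : E} (h₀ : F x₀ ≠ 0) :
    ∀ᵐ x ∂μ, F x ≠ 0 := by
  set G : E → ℂ := fun x => F (x₀ + x) with hG
  have hGa : AnalyticOnNhd ℝ G Set.univ := fun x _ =>
    (hF (x₀ + x) (Set.mem_univ _)).comp_of_eq (by fun_prop) rfl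
  have hGc : Continuous G := continuousOn_univ.1 hGa.continuousOn
  have hG0 : G 0 ≠ 0 := by simpa [hG] using h₀
  suffices h : ∀ᵐ x ∂μ, G x ≠ 0 by
    have := (eventually_add_left_iff μ (-x₀) (p := fun x => G x ≠ 0)).2 h
    simpa [hG] using this
  have hZ : MeasurableSet {x : E | G x ≠ 0} := (hGc.measurable (measurableSet_singleton 0)).compl
  have hray : ∀ᵐ z ∂(μ.toSphere.prod (Measure.volumeIoiPow (Module.finrank ℝ E - 1))),
      G ((homeomorphUnitSphereProd E).symm z : E) ≠ 0 := by
    rw [Measure.ae_prod_iff_ae_ae]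
    · refine Filter.Eventually.of_forall fun ω => ?_
      refine (withDensity_absolutelyContinuous _ _).ae_le ?_
      have h1 : ∀ᵐ t : ℝ, G (t • (ω : E)) ≠ 0 := by
        refine ae_ne_zero_of_analytic_real (t₀ := 0) (fun t _ => ?_) (by simpa using hG0)
        exact (hGa (t • (ω : E)) (Set.mem_univ _)).comp_of_eq (by fun_prop) rfl
      have h2 := (MeasurableEmbedding.subtype_coe (measurableSet_Ioi (a := (0 : ℝ)))).ae_map_iff
        (p := fun t => G (t • (ω : E)) ≠ 0) (μ := Measure.comap Subtype.val volume)
      rw [map_comap_subtype_coe measurableSet_Ioi] at h2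
      exact h2.1 (ae_restrict_of_ae h1)
    · exact (((homeomorphUnitSphereProd E).symm.continuous.measurable.subtype_val) hZ)
  have h3 := (Measure.measurePreserving_homeomorphUnitSphereProd μ).quasiMeasurePreserving.ae hray
  simp only [Homeomorph.symm_apply_apply] at h3
  have h4 := (MeasurableEmbedding.subtype_coe
    (measurableSet_singleton (0 : E)).compl).ae_map_iff (p := fun x => G x ≠ 0)
    (μ := μ.comap Subtype.val)
  rw [map_comap_subtype_coe (measurableSet_singleton (0 : E)).compl,
    ae_restrict_iff' (measurableSet_singleton (0 : E)).compl] at h4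
  filter_upwards [h4.2 h3] with x hx
  by_cases h : x = 0
  · rw [h]; exact hG0
  · exact hx h

/-- Injectivity of an analytic family of linear maps is generic once it holds at one point: if `R` is
a left inverse at `x₀`, then `det (R ∘ G x)` is analytic and equals `1` at `x₀`. -/
theorem ae_injective_of_analytic {E : Type*} [NormedAddCommGroup E] [NormedSpace ℝ E]
    [FiniteDimensional ℝ E] [MeasurableSpace E] [BorelSpace E] (μ : Measure E)
    [μ.IsAddHaarMeasure] {V W : Type*} [Fintype V] [Finite W]
    (G : E → (V → ℂ) →ₗ[ℂ] (W → ℂ))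
    (hG : ∀ φ w, AnalyticOnNhd ℝ (fun x => G x φ w) Set.univ) {x₀ : E}
    (h₀ : Function.Injective (G x₀)) :
    ∀ᵐ x ∂μ, Function.Injective (G x) := by
  classical
  have := Fintype.ofFinite W
  obtain ⟨R, hR⟩ := LinearMap.exists_leftInverse_of_injective (G x₀) (LinearMap.ker_eq_bot.2 h₀)
  set F : E → ℂ := fun x => (LinearMap.toMatrix' (R ∘ₗ G x)).det with hFdef
  have hF : AnalyticOnNhd ℝ F Set.univ := by
    intro x _
    simp only [hFdef, Matrix.det_apply']
    refine Finset.analyticAt_fun_sum _ fun σ _ => ?_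
    refine analyticAt_const.mul (Finset.analyticAt_fun_prod _ fun i _ => ?_)
    simp only [LinearMap.toMatrix'_apply, LinearMap.comp_apply]
    have : ∀ y : W → ℂ, R y (σ i) = ∑ w, y w * LinearMap.toMatrix' R (σ i) w := by
      intro y
      conv_lhs => rw [← LinearMap.toMatrix'_mulVec R y]
      simp [Matrix.mulVec, dotProduct, mul_comm]
    simp only [this]
    exact Finset.analyticAt_fun_sum _ fun w _ =>
      (hG _ w x (Set.mem_univ x)).mul analyticAt_const
  have hF0 : F x₀ ≠ 0 := by simp [hFdef, hR]
  filter_upwards [ae_ne_zero_of_analytic μ hF hF0] with x hx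
  have hu : IsUnit (R ∘ₗ G x) := by
    rw [LinearMap.isUnit_iff_isUnit_det, ← LinearMap.det_toMatrix']
    exact hx.isUnit
  have := ((Module.End.isUnit_iff _).1 hu).1
  rw [LinearMap.coe_comp] at this
  exact this.of_comp

/-! ### Cuts of a tensor and rigidity -/

/-- The coefficient matrix of the tensor `ψ` across the bipartition encoded by `e`: rows are
configurations of one side, columns configurations of the other. -/
def cutMatrix {V X Y : Type*} (e : X × Y ≃ V) (ψ : V → ℂ) : Matrix X Y ℂ :=
  Matrix.of fun x y => ψ (e (x, y))

/-- The linear condition on `φ`, for given `ψ`, that follows from `φ` and `ψ` having equal marginals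
on both sides of the cut `e`; see `CutCompatible.of_gram_eq`. -/
def CutCompatible {V X Y : Type*} [Fintype X] [Fintype Y] (e : X × Y ≃ V) (ψ φ : V → ℂ) : Prop :=
  cutMatrix e φ * (cutMatrix e ψ).conjTranspose * cutMatrix e ψ =
    cutMatrix e ψ * (cutMatrix e ψ).conjTranspose * cutMatrix e φ

/-- `ψ` is rigid with respect to two cuts if its multiples are the only tensors compatible with it
across both. -/
def Rigid {V X₁ Y₁ X₂ Y₂ : Type*} [Fintype X₁] [Fintype Y₁] [Fintype X₂] [Fintype Y₂]
    (e₁ : X₁ × Y₁ ≃ V) (e₂ : X₂ × Y₂ ≃ V) (ψ : V → ℂ) : Prop :=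
  ∀ φ : V → ℂ, CutCompatible e₁ ψ φ → CutCompatible e₂ ψ φ → ∃ c : ℂ, φ = c • ψ

theorem CutCompatible.of_gram_eq {V X Y : Type*} [Fintype X] [Fintype Y] (e : X × Y ≃ V)
    {ψ φ : V → ℂ}
    (h₁ : cutMatrix e φ * (cutMatrix e φ).conjTranspose =
      cutMatrix e ψ * (cutMatrix e ψ).conjTranspose)
    (h₂ : (cutMatrix e φ).conjTranspose * cutMatrix e φ =
      (cutMatrix e ψ).conjTranspose * cutMatrix e ψ) : CutCompatible e ψ φ := by
  rw [CutCompatible, Matrix.mul_assoc, ← h₂, ← Matrix.mul_assoc, h₁]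

/-- The linear map in `φ` whose kernel consists of the tensors compatible with `ψ` across the cut
`e`. -/
def cutDefect {V X Y : Type*} [Fintype X] [Fintype Y] (e : X × Y ≃ V) (ψ : V → ℂ) :
    (V → ℂ) →ₗ[ℂ] (X × Y → ℂ) where
  toFun φ p := (cutMatrix e φ * (cutMatrix e ψ).conjTranspose * cutMatrix e ψ -
    cutMatrix e ψ * (cutMatrix e ψ).conjTranspose * cutMatrix e φ) p.1 p.2
  map_add' φ φ' := by
    have : cutMatrix e (φ + φ') = cutMatrix e φ + cutMatrix e φ' := rfl
    ext p
    simp only [this, Matrix.add_mul, Matrix.mul_add, Matrix.sub_apply, Matrix.add_apply,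
      Pi.add_apply]
    ring
  map_smul' c φ := by
    have : cutMatrix e (c • φ) = c • cutMatrix e φ := rfl
    ext p
    simp only [this, Matrix.smul_mul, Matrix.mul_smul, Matrix.sub_apply, Matrix.smul_apply,
      Pi.smul_apply, RingHom.id_apply, smul_sub]

theorem cutDefect_eq_zero_iff {V X Y : Type*} [Fintype X] [Fintype Y] (e : X × Y ≃ V)
    (ψ φ : V → ℂ) : cutDefect e ψ φ = 0 ↔ CutCompatible e ψ φ := by
  rw [CutCompatible, ← sub_eq_zero (b := cutMatrix e ψ * _ * _), ← Matrix.ext_iff, funext_iff,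
    Prod.forall]
  rfl

theorem analyticOnNhd_cutDefect {V X Y : Type*} [Fintype V] [Fintype X] [Fintype Y]
    (e : X × Y ≃ V) (φ : V → ℂ) (p : X × Y) :
    AnalyticOnNhd ℝ (fun ψ : EuclideanSpace ℂ V => cutDefect e ψ φ p) Set.univ := by
  intro ψ _
  have hc : ∀ v, AnalyticAt ℝ (fun ψ : EuclideanSpace ℂ V => ψ v) ψ := fun v =>
    ((EuclideanSpace.proj v : EuclideanSpace ℂ V →L[ℂ] ℂ).restrictScalars ℝ).analyticAt ψ
  have hs : ∀ v, AnalyticAt ℝ (fun ψ : EuclideanSpace ℂ V => star (ψ v)) ψ := fun v =>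
    (Complex.conjCLE.toContinuousLinearMap.analyticAt _).comp (hc v)
  simp only [cutDefect, LinearMap.coe_mk, AddHom.coe_mk, Matrix.sub_apply, Matrix.mul_apply,
    Matrix.conjTranspose_apply, cutMatrix, Matrix.of_apply]
  refine AnalyticAt.sub ?_ ?_
  · exact Finset.analyticAt_fun_sum _ fun x _ => AnalyticAt.mul
      (Finset.analyticAt_fun_sum _ fun y _ => analyticAt_const.mul (hs _)) (hc _)
  · exact Finset.analyticAt_fun_sum _ fun x _ => AnalyticAt.mul
      (Finset.analyticAt_fun_sum _ fun y _ => (hc _).mul (hs _)) analyticAt_const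

/-- Rigidity is generic once a single nonzero rigid tensor exists. -/
theorem ae_rigid {V X₁ Y₁ X₂ Y₂ : Type*} [Fintype V] [Fintype X₁] [Fintype Y₁] [Fintype X₂]
    [Fintype Y₂] (e₁ : X₁ × Y₁ ≃ V) (e₂ : X₂ × Y₂ ≃ V) {ψ₀ : V → ℂ} (h₀ : ψ₀ ≠ 0)
    (h : Rigid e₁ e₂ ψ₀) : ∀ᵐ ψ : EuclideanSpace ℂ V, Rigid e₁ e₂ ψ := by
  obtain ⟨v₀, hv₀⟩ := Function.ne_iff.1 h₀
  -- The last component removes the multiples of `ψ₀` from the kernel.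
  set G : (V → ℂ) → (V → ℂ) →ₗ[ℂ] ((X₁ × Y₁) ⊕ (X₂ × Y₂) ⊕ Unit → ℂ) := fun ψ =>
    LinearMap.pi (Sum.elim (fun p => LinearMap.proj p ∘ₗ cutDefect e₁ ψ)
      (Sum.elim (fun p => LinearMap.proj p ∘ₗ cutDefect e₂ ψ) fun _ => LinearMap.proj v₀)) with hG
  have hzero : ∀ ψ φ, G ψ φ = 0 ↔ CutCompatible e₁ ψ φ ∧ CutCompatible e₂ ψ φ ∧ φ v₀ = 0 := by
    intro ψ φ
    rw [← cutDefect_eq_zero_iff, ← cutDefect_eq_zero_iff]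
    simp [hG, funext_iff]
  have hae : ∀ᵐ ψ : EuclideanSpace ℂ V, Function.Injective (G ψ) := by
    refine ae_injective_of_analytic volume (fun ψ : EuclideanSpace ℂ V => G ψ) (fun φ w => ?_)
      (x₀ := WithLp.toLp 2 ψ₀) ?_
    · rcases w with p | p | _
      · exact analyticOnNhd_cutDefect e₁ φ p
      · exact analyticOnNhd_cutDefect e₂ φ p
      · exact analyticOnNhd_const
    · rw [injective_iff_map_eq_zero]
      intro φ hφ
      obtain ⟨h1, h2, h3⟩ := (hzero _ _).1 hφ
      obtain ⟨c, rfl⟩ := h φ h1 h2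
      have : c = 0 := (mul_eq_zero.1 h3).resolve_right hv₀
      simp [this]
  have hne : ∀ᵐ ψ : EuclideanSpace ℂ V, ψ v₀ ≠ 0 :=
    ae_ne_zero_of_analytic volume (x₀ := WithLp.toLp 2 ψ₀) (fun ψ _ =>
      ((EuclideanSpace.proj v₀ : EuclideanSpace ℂ V →L[ℂ] ℂ).restrictScalars ℝ).analyticAt ψ) hv₀
  filter_upwards [hae, hne] with ψ hψ hv φ h1 h2
  rw [injective_iff_map_eq_zero] at hψ
  have key : ∀ ψ' : V → ℂ, CutCompatible e₁ ψ ψ' → CutCompatible e₂ ψ ψ' → ψ' v₀ = 0 → ψ' = 0 :=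
    fun ψ' a b c => hψ ψ' ((hzero _ _).2 ⟨a, b, c⟩)
  refine ⟨φ v₀ / ψ v₀, ?_⟩
  rw [← sub_eq_zero]
  refine key _ ?_ ?_ (by simp [hv])
  all_goals
    rw [← cutDefect_eq_zero_iff] at *
    rw [map_sub, map_smul, (cutDefect_eq_zero_iff _ _ _).2 rfl]
    simpa

/-- A property that descends along positive scalings and holds almost everywhere in the space holds
almost everywhere on the unit sphere. -/
theorem ae_toSphere_of_ae {E : Type*} [NormedAddCommGroup E] [NormedSpace ℝ E]
    [FiniteDimensional ℝ E] [MeasurableSpace E] [BorelSpace E] (μ : Measure E)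
    [μ.IsAddHaarMeasure] {p : E → Prop} (hp : ∀ (r : ℝ) x, 0 < r → p (r • x) → p x)
    (h : ∀ᵐ x ∂μ, p x) : ∀ᵐ (ω : Metric.sphere (0 : E) 1) ∂μ.toSphere, p ω := by
  have h1 : ∀ᵐ (x : ({0}ᶜ : Set E)) ∂(μ.comap Subtype.val), p x := by
    have h2 := (MeasurableEmbedding.subtype_coe
      (measurableSet_singleton (0 : E)).compl).ae_map_iff (p := p) (μ := μ.comap Subtype.val)
    rw [map_comap_subtype_coe (measurableSet_singleton (0 : E)).compl] at h2
    exact h2.1 (ae_restrict_of_ae h)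
  have h3 : ∀ᵐ z ∂(μ.toSphere.prod (Measure.volumeIoiPow (Module.finrank ℝ E - 1))),
      p ((homeomorphUnitSphereProd E).symm z : E) := by
    rw [← (Measure.measurePreserving_homeomorphUnitSphereProd μ).map_eq,
      (homeomorphUnitSphereProd E).measurableEmbedding.ae_map_iff]
    simpa only [Homeomorph.symm_apply_apply] using h1
  have hne : (ae (Measure.volumeIoiPow (Module.finrank ℝ E - 1))).NeBot := by
    rw [ae_neBot]
    intro h0
    have := Measure.volumeIoiPow_apply_Iio (Module.finrank ℝ E - 1) ⟨1, Set.mem_Ioi.2 one_pos⟩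
    rw [h0] at this
    simp only [Measure.coe_zero, Pi.zero_apply, one_pow] at this
    exact (ENNReal.ofReal_pos.2 (by positivity)).ne this
  filter_upwards [Measure.ae_ae_of_ae_prod h3] with ω hω
  obtain ⟨r, hr⟩ := hω.exists
  exact hp r ω r.2 (by simpa using hr)

theorem CutCompatible.of_smul {V X Y : Type*} [Fintype X] [Fintype Y] {e : X × Y ≃ V}
    {ψ φ : V → ℂ} (c : ℂ) (h : CutCompatible e ψ φ) : CutCompatible e (c • ψ) φ := by
  have hc : cutMatrix e (c • ψ) = c • cutMatrix e ψ := rfl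
  rw [CutCompatible] at *
  simp only [hc, Matrix.conjTranspose_smul, Matrix.mul_smul, Matrix.smul_mul, h, smul_smul,
    mul_comm]

theorem Rigid.of_smul {V X₁ Y₁ X₂ Y₂ : Type*} [Fintype X₁] [Fintype Y₁] [Fintype X₂]
    [Fintype Y₂] {e₁ : X₁ × Y₁ ≃ V} {e₂ : X₂ × Y₂ ≃ V} {ψ : V → ℂ} (c : ℂ)
    (h : Rigid e₁ e₂ (c • ψ)) : Rigid e₁ e₂ ψ := by
  intro φ h1 h2
  obtain ⟨b, hb⟩ := h φ (h1.of_smul c) (h2.of_smul c)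
  exact ⟨b * c, by rw [hb, smul_smul]⟩

theorem CutCompatible.of_equiv {V X Y V' X' Y' : Type*} [Fintype X] [Fintype Y] [Fintype X']
    [Fintype Y'] {e : X × Y ≃ V} {e' : X' × Y' ≃ V'} (h : V ≃ V') (f : X ≃ X') (g : Y ≃ Y')
    (H : ∀ x y, h (e (x, y)) = e' (f x, g y)) {ψ φ : V' → ℂ}
    (hc : CutCompatible e (ψ ∘ h) (φ ∘ h)) : CutCompatible e' ψ φ := by
  have hcut : ∀ χ : V' → ℂ, cutMatrix e' χ = (cutMatrix e (χ ∘ h)).submatrix f.symm g.symm := by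
    intro χ
    ext x y
    simp [cutMatrix, H]
  rw [CutCompatible] at *
  simp only [hcut, Matrix.conjTranspose_submatrix, Matrix.submatrix_mul_equiv, hc]

theorem Rigid.of_equiv {V X₁ Y₁ X₂ Y₂ V' X₁' Y₁' X₂' Y₂' : Type*} [Fintype X₁] [Fintype Y₁]
    [Fintype X₂] [Fintype Y₂] [Fintype X₁'] [Fintype Y₁'] [Fintype X₂'] [Fintype Y₂']
    {e₁ : X₁ × Y₁ ≃ V} {e₂ : X₂ × Y₂ ≃ V} {e₁' : X₁' × Y₁' ≃ V'} {e₂' : X₂' × Y₂' ≃ V'}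
    (h : V ≃ V') (f₁ : X₁ ≃ X₁') (g₁ : Y₁ ≃ Y₁') (f₂ : X₂ ≃ X₂') (g₂ : Y₂ ≃ Y₂')
    (H₁ : ∀ x y, h (e₁ (x, y)) = e₁' (f₁ x, g₁ y)) (H₂ : ∀ x y, h (e₂ (x, y)) = e₂' (f₂ x, g₂ y))
    {ψ : V' → ℂ} (hψ : Rigid e₁' e₂' ψ) : Rigid e₁ e₂ (ψ ∘ h) := by
  intro φ h1 h2
  have hφ : φ = (φ ∘ h.symm) ∘ h := by ext; simp
  rw [hφ] at h1 h2
  obtain ⟨c, hc⟩ := hψ (φ ∘ h.symm) (h1.of_equiv h f₁ g₁ H₁) (h2.of_equiv h f₂ g₂ H₂)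
  exact ⟨c, by rw [hφ, hc]; rfl⟩

/-! ### A rigid tensor -/

/-- If the rows of `M` are orthogonal with distinct nonzero square norms, a matrix compatible with `M`
arises from `M` by rescaling the rows: `M' Mᴴ` commutes with the diagonal matrix `M Mᴴ`, hence is
itself diagonal. -/
theorem exists_row_scaling {X Y : Type*} [Fintype X] [Fintype Y] [DecidableEq X]
    {M M' : Matrix X Y ℂ} {D : X → ℂ} (hD : M * M.conjTranspose = Matrix.diagonal D)
    (hinj : Function.Injective D) (h0 : ∀ x, D x ≠ 0)
    (h : M' * M.conjTranspose * M = M * M.conjTranspose * M') :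
    ∃ r : X → ℂ, ∀ x y, M' x y = r x * M x y := by
  have hcomm : (M' * M.conjTranspose) * Matrix.diagonal D =
      Matrix.diagonal D * (M' * M.conjTranspose) := by
    rw [← hD, ← Matrix.mul_assoc, h, ← Matrix.mul_assoc]
  have hoff : ∀ x y, x ≠ y → (M' * M.conjTranspose) x y = 0 := by
    intro x y hxy
    have := congrFun (congrFun hcomm x) y
    rw [Matrix.mul_diagonal, Matrix.diagonal_mul, mul_comm] at this
    by_contra hne
    exact hxy (hinj (mul_right_cancel₀ hne this).symm)
  refine ⟨fun x => (M' * M.conjTranspose) x x / D x, fun x z => ?_⟩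
  have := congrFun (congrFun h x) z
  rw [hD, Matrix.diagonal_mul, Matrix.mul_apply, Finset.sum_eq_single x] at this
  · rw [div_mul_eq_mul_div, this, mul_div_cancel_left₀ _ (h0 x)]
  · intro y _ hy
    rw [hoff x y hy.symm, zero_mul]
  · simp

/-- The `t`-th standard basis vector, or, if `p` holds, its image under `1 - τ h hᵀ`. When
`τ |h|² = 2` the latter map is the reflection in the hyperplane orthogonal to `h`. -/
def reflectedBasis {U : Type*} [DecidableEq U] (h : U → ℝ) (τ : ℝ) (p : Prop) [Decidable p]
    (t d : U) : ℝ :=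
  (if d = t then 1 else 0) - if p then τ * h t * h d else 0

/-- Two vectors of the same kind are orthonormal; for two of different kinds only the matrix entry of
the reflection survives. -/
theorem sum_reflectedBasis_mul {U : Type*} [Fintype U] [DecidableEq U] {h : U → ℝ} {τ : ℝ}
    (hτ : τ * ∑ u, h u ^ 2 = 2) (p q : Prop) [Decidable p] [Decidable q] (s t : U) :
    ∑ d, reflectedBasis h τ p s d * reflectedBasis h τ q t d =
      (if s = t then 1 else 0) - if p ↔ q then 0 else τ * h s * h t := by
  have hsum : ∑ d, τ * h s * h d * (τ * h t * h d) = 2 * (τ * h s * h t) := by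
    rw [← hτ, Finset.mul_sum, Finset.sum_mul]
    exact Finset.sum_congr rfl fun d _ => by ring
  by_cases hp : p <;> by_cases hq : q <;>
    simp [reflectedBasis, hp, hq, sub_mul, mul_sub, Finset.sum_sub_distrib, hsum,
      eq_comm (a := t)] <;> ring

section Witness

variable {κ ι : Type*} [Fintype κ] [Fintype ι] [DecidableEq κ] [DecidableEq ι] [AddCommGroup ι]

/-- The vectors `w_{u,b}`: for a fixed second component of `u` they form an orthonormal basis, which
is the standard one, in shifted order, if this component is nonzero, and its reflection otherwise. -/
def frame (h : κ × ι → ℝ) (τ : ℝ) (u : κ × ι) (b : ι) (d : κ × ι) : ℝ :=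
  reflectedBasis h τ (u.2 = 0) (u.1, b + u.2) d

theorem sum_frame_mul_of_eq {h : κ × ι → ℝ} {τ : ℝ} (hτ : τ * ∑ u, h u ^ 2 = 2)
    {u v : κ × ι} (huv : u.2 = v.2) (b b' : ι) :
    ∑ d, frame h τ u b d * frame h τ v b' d = if (u, b) = (v, b') then 1 else 0 := by
  obtain ⟨k, c⟩ := u
  obtain ⟨k', c'⟩ := v
  obtain rfl : c = c' := huv
  simp only [frame]
  rw [sum_reflectedBasis_mul hτ]
  simp

theorem sum_frame_mul_neg {h : κ × ι → ℝ} {τ : ℝ} (hτ : τ * ∑ u, h u ^ 2 = 2) (hτ0 : 0 < τ)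
    (hpos : ∀ u, 0 < h u) {u v : κ × ι} (hu : u.2 = 0) (hv : v.2 ≠ 0) (b : ι) :
    ∑ d, frame h τ u b d * frame h τ v b d < 0 := by
  simp only [frame]
  rw [sum_reflectedBasis_mul hτ]
  have : ¬ (u.2 = 0 ↔ v.2 = 0) := by tauto
  have h2 : (u.1, b + u.2) ≠ (v.1, b + v.2) := by
    intro h
    rw [Prod.mk.injEq, add_right_inj, hu] at h
    exact hv h.2.symm
  rw [if_neg this, if_neg h2, zero_sub, neg_lt_zero]
  exact mul_pos (mul_pos hτ0 (hpos _)) (hpos _)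

/-- For fixed `b`, the vectors `w_{v,b}` are linearly independent. The hypothesis `hb` says that the
reflection restricted to the span of the standard basis vectors with second component `b` is
invertible. -/
theorem frame_independent {h : κ × ι → ℝ} {τ : ℝ} {b : ι}
    (hb : τ * ∑ k, h (k, b) ^ 2 ≠ 1) {x : κ × ι → ℂ}
    (hx : ∀ d, ∑ v, x v * (frame h τ v b d : ℂ) = 0) (v : κ × ι) : x v = 0 := by
  -- Coordinatewise, `x v` is determined by the scalar `S`, and `S` is a fixed multiple of itself.
  set S : ℂ := ∑ k, x (k, 0) * (h (k, b) : ℂ) with hS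
  have hxv : ∀ v : κ × ι, x v = τ * S * h (v.1, b + v.2) := by
    intro v
    have h1 := hx (v.1, b + v.2)
    have h2 : ∀ w : κ × ι, x w * (frame h τ w b (v.1, b + v.2) : ℂ) =
        (if v = w then x w else 0) -
          if w.2 = 0 then x w * (τ * h (w.1, b + w.2) * h (v.1, b + v.2)) else 0 := by
      intro w
      have : (v.1, b + v.2) = (w.1, b + w.2) ↔ v = w := by
        simp [Prod.ext_iff]
      simp only [frame, reflectedBasis, this]
      split_ifs <;> push_cast <;> ring
    simp only [h2, Finset.sum_sub_distrib, Finset.sum_ite_eq, Finset.mem_univ, if_true,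
      sub_eq_zero] at h1
    rw [h1, Fintype.sum_prod_type]
    simp only [Finset.sum_ite_eq', Finset.mem_univ, if_true, add_zero, hS, Finset.mul_sum,
      Finset.sum_mul]
    exact Finset.sum_congr rfl fun k _ => by ring
  have hS0 : S = 0 := by
    have h1 : S = ∑ k, (τ * S * h (k, b) * h (k, b) : ℂ) :=
      Finset.sum_congr rfl fun k _ => by rw [hxv (k, 0), add_zero]
    clear_value S
    have h2 : ∑ k, (τ * S * h (k, b) * h (k, b) : ℂ) = (τ * ∑ k, h (k, b) ^ 2 : ℝ) * S := by
      push_cast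
      rw [Finset.mul_sum, Finset.sum_mul]
      exact Finset.sum_congr rfl fun k _ => by ring
    rw [h2] at h1
    by_contra hne
    have := mul_right_cancel₀ hne ((one_mul S).trans h1)
    exact hb (by exact_mod_cast this.symm)
  rw [hxv, hS0]; simp

/-- The rigid tensor: the third index repeats the second component of the first one, and the last
index carries the vectors of `frame`, weighted by `m`. -/
def witness (m : (κ × ι) × ι → ℝ) (h : κ × ι → ℝ) (τ : ℝ) :
    (κ × ι) × ι × ι × (κ × ι) → ℂ := fun v =>
  if v.1.2 = v.2.2.1 then ((m (v.1, v.2.1) * frame h τ v.1 v.2.1 v.2.2.2 : ℝ) : ℂ) else 0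

/-- The cut `αβ | γδ`. -/
def splitABCD (α β γ δ : Type*) : (α × β) × (γ × δ) ≃ α × β × γ × δ :=
  Equiv.prodAssoc α β (γ × δ)

/-- The cut `αγ | βδ`. -/
def splitACBD (α β γ δ : Type*) : (α × γ) × (β × δ) ≃ α × β × γ × δ where
  toFun p := (p.1.1, p.2.1, p.1.2, p.2.2)
  invFun v := ((v.1, v.2.2.1), (v.2.1, v.2.2.2))
  left_inv _ := rfl
  right_inv _ := rfl

theorem witness_gram {m : (κ × ι) × ι → ℝ} {h : κ × ι → ℝ} {τ : ℝ}
    (hτ : τ * ∑ u, h u ^ 2 = 2) :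
    cutMatrix (splitABCD (κ × ι) ι ι (κ × ι)) (witness m h τ) *
      (cutMatrix (splitABCD (κ × ι) ι ι (κ × ι)) (witness m h τ)).conjTranspose =
    Matrix.diagonal fun x => ((m x ^ 2 : ℝ) : ℂ) := by
  ext ⟨u, b⟩ ⟨v, b'⟩
  simp only [Matrix.mul_apply, Matrix.conjTranspose_apply, cutMatrix, Matrix.of_apply, splitABCD,
    Equiv.prodAssoc_apply, witness, Fintype.sum_prod_type (α₁ := ι) (α₂ := κ × ι)]
  rw [Finset.sum_eq_single u.2 (fun c _ hc => by simp [hc.symm]) (by simp)]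
  by_cases huv : u.2 = v.2
  · have h1 := sum_frame_mul_of_eq hτ huv b b'
    have h2 : ∀ d, (m (u, b) * frame h τ u b d) * (m (v, b') * frame h τ v b' d) =
        m (u, b) * m (v, b') * (frame h τ u b d * frame h τ v b' d) := fun d => by ring
    simp only [huv, if_true, RCLike.star_def, Complex.conj_ofReal, ← Complex.ofReal_mul,
      ← Complex.ofReal_sum, h2, ← Finset.mul_sum, h1, Matrix.diagonal_apply]
    by_cases he : (u, b) = (v, b')
    · rw [if_pos he, if_pos he, he]; simp [sq]
    · rw [if_neg he, if_neg he]; simp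
  · have : (u, b) ≠ (v, b') := fun he => huv (by rw [(Prod.mk.inj he).1])
    rw [Matrix.diagonal_apply_ne _ this]
    simp [Ne.symm huv]

theorem rigid_witness [Nontrivial ι] [Nonempty κ] {m : (κ × ι) × ι → ℝ} {h : κ × ι → ℝ} {τ : ℝ}
    (hm : ∀ x, 0 < m x) (hinj : Function.Injective m) (hpos : ∀ u, 0 < h u)
    (hτ : τ * ∑ u, h u ^ 2 = 2) (hb : ∀ b, τ * ∑ k, h (k, b) ^ 2 ≠ 1) :
    Rigid (splitABCD (κ × ι) ι ι (κ × ι)) (splitACBD (κ × ι) ι ι (κ × ι)) (witness m h τ) := by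
  have hτ0 : 0 < τ := by
    by_contra hneg
    have : 0 ≤ ∑ u, h u ^ 2 := Finset.sum_nonneg fun u _ => sq_nonneg _
    nlinarith [mul_nonneg (sub_nonneg.2 (not_lt.1 hneg)) this]
  intro φ h₁ h₂
  obtain ⟨r, hr⟩ := exists_row_scaling (witness_gram hτ)
    (fun x y hxy => hinj ((sq_eq_sq₀ (hm x).le (hm y).le).1 (Complex.ofReal_injective hxy)))
    (fun x => by exact_mod_cast (pow_pos (hm x) 2).ne') h₁
  have hφ : ∀ u b c d, φ (u, b, c, d) = r (u, b) * witness m h τ (u, b, c, d) :=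
    fun u b c d => hr (u, b) (c, d)
  -- `s u v b` is the contribution of `b` to the overlap of the rows `(u, u.2)` and `(v, v.2)` of the
  -- second cut; all other rows vanish.
  set T : κ × ι → ι → κ × ι → ℝ := fun u b d => m (u, b) * frame h τ u b d with hT
  set s : κ × ι → κ × ι → ι → ℝ := fun u v b => ∑ d, T u b d * T v b d with hs
  have hs_eq : ∀ u v b, s u v b =
      m (u, b) * m (v, b) * ∑ d, frame h τ u b d * frame h τ v b d := by
    intro u v b
    rw [hs, Finset.mul_sum]
    exact Finset.sum_congr rfl fun d _ => by rw [hT]; ring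
  have hK : ∀ u b d, ∑ v, ((∑ b', r (u, b') * (s u v b' : ℂ)) -
      ((∑ b', s u v b' : ℝ) : ℂ) * r (v, b)) * m (v, b) * (frame h τ v b d : ℂ) = 0 := by
    intro u b d
    have := congrFun (congrFun h₂ (u, u.2)) (b, d)
    simp only [Matrix.mul_apply, Matrix.conjTranspose_apply, cutMatrix, Matrix.of_apply,
      splitACBD, Equiv.coe_fn_mk, hφ] at this
    rw [← sub_eq_zero, ← Finset.sum_sub_distrib, Fintype.sum_prod_type] at this
    rw [← this]
    refine Finset.sum_congr rfl fun v _ => ?_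
    refine Eq.trans ?_ (Finset.sum_eq_single v.2 (fun c _ hc => by simp [witness, hc.symm])
      (by simp)).symm
    simp only [witness, if_true, Fintype.sum_prod_type (α₁ := ι) (α₂ := κ × ι), hs, hT,
      RCLike.star_def, Complex.conj_ofReal]
    push_cast
    simp only [Finset.mul_sum, mul_assoc, sub_mul]
  have h_overlap : ∀ u v b, ∑ b', r (u, b') * (s u v b' : ℂ) =
      ((∑ b', s u v b' : ℝ) : ℂ) * r (v, b) := by
    intro u v b
    have := frame_independent (hb b) (hK u b) v
    rw [mul_eq_zero, sub_eq_zero] at this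
    exact this.resolve_right (by exact_mod_cast (hm _).ne')
  have hrow : ∀ v b, r (v, b) = r (v, 0) := by
    intro v b
    have hne : ((∑ b', s v v b' : ℝ) : ℂ) ≠ 0 := by
      have : 0 < ∑ b', s v v b' := by
        refine Finset.sum_pos (fun b' _ => ?_) Finset.univ_nonempty
        rw [hs_eq, sum_frame_mul_of_eq hτ rfl, if_pos rfl, mul_one]
        exact mul_pos (hm _) (hm _)
      exact_mod_cast this.ne'
    exact mul_left_cancel₀ hne ((h_overlap v v b).symm.trans (h_overlap v v 0))
  have hpair : ∀ u v : κ × ι, u.2 = 0 → v.2 ≠ 0 → r (u, 0) = r (v, 0) := by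
    intro u v hu hv
    have hne : ((∑ b', s u v b' : ℝ) : ℂ) ≠ 0 := by
      have : ∑ b', s u v b' < 0 := by
        refine Finset.sum_neg (fun b' _ => ?_) Finset.univ_nonempty
        rw [hs_eq]
        exact mul_neg_of_pos_of_neg (mul_pos (hm _) (hm _)) (sum_frame_mul_neg hτ hτ0 hpos hu hv b')
      exact_mod_cast this.ne
    have h1 := h_overlap u v 0
    simp only [hrow u, ← Finset.mul_sum] at h1
    rw [← Complex.ofReal_sum, mul_comm] at h1
    exact mul_left_cancel₀ hne h1
  obtain ⟨k₀⟩ := ‹Nonempty κ›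
  obtain ⟨c₀, hc₀⟩ := exists_ne (0 : ι)
  refine ⟨r ((k₀, 0), 0), funext fun ⟨u, b, c, d⟩ => ?_⟩
  rw [hφ, hrow, Pi.smul_apply, smul_eq_mul]
  congr 1
  by_cases hu : u.2 = 0
  · rw [hpair u (k₀, c₀) hu hc₀, hpair (k₀, 0) (k₀, c₀) rfl hc₀]
  · exact (hpair (k₀, 0) u rfl hu).symm

end Witness

/-- Rigid tensors exist for the dimensions `(kq, q, q, kq)`. -/
theorem exists_rigid {α β γ δ : Type*} [Fintype α] [Fintype β] [Fintype γ] [Fintype δ] {k q : ℕ}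
    (hk : 1 ≤ k) (hq : 2 ≤ q) (hα : Fintype.card α = k * q) (hβ : Fintype.card β = q)
    (hγ : Fintype.card γ = q) (hδ : Fintype.card δ = k * q) :
    ∃ ψ : α × β × γ × δ → ℂ, ψ ≠ 0 ∧ Rigid (splitABCD α β γ δ) (splitACBD α β γ δ) ψ := by
  have : NeZero q := ⟨by lia⟩
  have : Fact (1 < q) := ⟨hq⟩
  have : Nonempty (Fin k) := ⟨⟨0, hk⟩⟩
  let m : (Fin k × ZMod q) × ZMod q → ℝ := fun x => (Fintype.equivFin _ x : ℕ) + 1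
  -- With these values `2 |h(·, b)|² / |h|²` is `2` or `8` divided by the odd number `4 q - 3`, hence
  -- never `1`.
  let h : Fin k × ZMod q → ℝ := fun u => if u.2 = 0 then 1 else 2
  have hm : ∀ x, 0 < m x := fun x => by positivity
  have hinj : Function.Injective m := by
    intro x y hxy
    have h1 : ((Fintype.equivFin _ x : ℕ) : ℝ) = (Fintype.equivFin _ y : ℕ) := add_right_cancel hxy
    exact (Fintype.equivFin _).injective (Fin.ext (by exact_mod_cast h1))
  have hpos : ∀ u, 0 < h u := fun u => by
    simp only [h]
    split_ifs <;> norm_num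
  have hfib : ∀ b, ∑ i, h (i, b) ^ 2 = k * (if b = 0 then 1 else 4) := by
    intro b
    simp only [h]
    split_ifs <;> norm_num
  have hsum : ∑ u, h u ^ 2 = k * (4 * q - 3) := by
    rw [Fintype.sum_prod_type_right]
    simp only [hfib, ← Finset.mul_sum]
    congr 1
    have : ∀ b : ZMod q, (if b = 0 then (1 : ℝ) else 4) = 4 - if b = 0 then 3 else 0 := by
      intro b
      split_ifs <;> norm_num
    simp [this, Finset.sum_sub_distrib, ZMod.card, mul_comm]
  have hk0 : (0 : ℝ) < k := by exact_mod_cast hk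
  have hq0 : (0 : ℝ) < 4 * q - 3 := by
    have : (2 : ℝ) ≤ q := by exact_mod_cast hq
    linarith
  have hrigid := rigid_witness (m := m) (h := h) (τ := 2 / (k * (4 * q - 3))) hm hinj hpos
    (by rw [hsum]; field_simp) (by
      intro b hb
      rw [hfib, div_mul_eq_mul_div, div_eq_one_iff_eq (by positivity)] at hb
      have h1 : 2 * (if b = 0 then (1 : ℝ) else 4) = 4 * q - 3 :=
        mul_left_cancel₀ hk0.ne' (by linarith)
      have h2 : 2 * (if b = 0 then (1 : ℤ) else 4) = 4 * q - 3 := by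
        split_ifs at h1 ⊢ <;> exact_mod_cast h1
      split_ifs at h2 <;> lia)
  have eα : α ≃ Fin k × ZMod q := Fintype.equivOfCardEq (by simp [hα, ZMod.card])
  have eβ : β ≃ ZMod q := Fintype.equivOfCardEq (by simp [hβ, ZMod.card])
  have eγ : γ ≃ ZMod q := Fintype.equivOfCardEq (by simp [hγ, ZMod.card])
  have eδ : δ ≃ Fin k × ZMod q := Fintype.equivOfCardEq (by simp [hδ, ZMod.card])
  let e := eα.prodCongr (eβ.prodCongr (eγ.prodCongr eδ))
  refine ⟨_, ?_, Rigid.of_equiv e (eα.prodCongr eβ) (eγ.prodCongr eδ) (eα.prodCongr eγ)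
    (eβ.prodCongr eδ) (fun _ _ => rfl) (fun _ _ => rfl) hrigid⟩
  intro hzero
  have i₀ : Fin k := ⟨0, hk⟩
  have h1 := congrFun hzero (e.symm ((i₀, 1), 0, 1, (i₀, 1)))
  simp [witness, frame, reflectedBasis, (hm _).ne'] at h1

/-- A configuration of all particles is one of the particles in `J` and one of the others, combined
by `glue`. -/
def glueEquiv {N d : ℕ} (J : Finset (Fin N)) :
    ({i // i ∈ J} → Fin d) × ({i // i ∉ J} → Fin d) ≃ (Fin N → Fin d) :=
  (Equiv.piEquivPiSubtypeProd (· ∈ J) fun _ => Fin d).symm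

theorem glueEquiv_apply {N d : ℕ} (J : Finset (Fin N)) (x : {i // i ∈ J} → Fin d)
    (z : {i // i ∉ J} → Fin d) : glueEquiv J (x, z) = glue J x z := rfl

/-- Restriction of families on `p` to `s` and `t`, when `p` is the disjoint union of `s` and `t`. -/
def restrictEquiv {I T : Type*} (p s t : I → Prop) [DecidablePred s] (hs : ∀ i, s i → p i)
    (ht : ∀ i, t i → p i) (hcover : ∀ i, p i → s i ∨ t i) (hdisj : ∀ i, s i → ¬ t i) :
    ({i // p i} → T) ≃ ({i // s i} → T) × ({i // t i} → T) where
  toFun x := (fun i => x ⟨i, hs i i.2⟩, fun i => x ⟨i, ht i i.2⟩)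
  invFun y i := if h : s i then y.1 ⟨i, h⟩ else y.2 ⟨i, (hcover i i.2).resolve_left h⟩
  left_inv x := by
    ext i
    by_cases h : s i <;> simp [h]
  right_inv y := by
    ext i
    · simp [i.2]
    · have : ¬ s i := fun h => hdisj i h i.2
      simp [this]

/-- The local dimensions `d ^ |A|` and `d ^ |B|` are of the form `kq` and `q` because `|B| ≤ |A|`. -/
theorem exists_rigid_glue {N d : ℕ} (hd : 1 ≤ d) {A B C D : Finset (Fin N)} (hB : B.Nonempty)
    (hAB : Disjoint A B) (hAC : Disjoint A C) (hAD : Disjoint A D) (hBC : Disjoint B C)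
    (hBD : Disjoint B D) (hCD : Disjoint C D) (hU : A ∪ B ∪ C ∪ D = Finset.univ)
    (hDA : D.card = A.card) (hCB : C.card = B.card) (hBA : B.card ≤ A.card) :
    ∃ ψ : (Fin N → Fin d) → ℂ, ψ ≠ 0 ∧ Rigid (glueEquiv (A ∪ B)) (glueEquiv (A ∪ C)) ψ := by
  -- For `d = 1` the space is one-dimensional.
  rcases hd.eq_or_lt with rfl | hd
  · refine ⟨1, one_ne_zero, fun φ _ _ => ⟨φ 0, funext fun x => ?_⟩⟩
    rw [Subsingleton.elim x 0]
    simp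
  have mem : ∀ i, i ∈ A ∨ i ∈ B ∨ i ∈ C ∨ i ∈ D := fun i => by
    have := Finset.mem_univ i
    simpa [← hU, or_assoc] using this
  rw [Finset.disjoint_left] at *
  have card_fun : ∀ J : Finset (Fin N), Fintype.card ({i // i ∈ J} → Fin d) = d ^ J.card := by
    intro J; simp
  have hpow : d ^ A.card = d ^ (A.card - B.card) * d ^ B.card := by
    rw [← pow_add, Nat.sub_add_cancel hBA]
  obtain ⟨ψ, hψ0, hψ⟩ := exists_rigid (α := {i // i ∈ A} → Fin d) (β := {i // i ∈ B} → Fin d)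
    (γ := {i // i ∈ C} → Fin d) (δ := {i // i ∈ D} → Fin d)
    (k := d ^ (A.card - B.card)) (q := d ^ B.card) (Nat.one_le_pow _ _ (by lia))
    (hd.trans_le (Nat.le_self_pow hB.card_pos.ne' d))
    (by rw [card_fun, hpow]) (card_fun B) (by rw [card_fun, hCB]) (by rw [card_fun, hDA, hpow])
  let f₁ := restrictEquiv (T := Fin d) (· ∈ A ∪ B) (· ∈ A) (· ∈ B) (by grind) (by grind)
    (by grind) (by grind)
  let g₁ := restrictEquiv (T := Fin d) (· ∉ A ∪ B) (· ∈ C) (· ∈ D) (by grind) (by grind)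
    (by grind) (by grind)
  let f₂ := restrictEquiv (T := Fin d) (· ∈ A ∪ C) (· ∈ A) (· ∈ C) (by grind) (by grind)
    (by grind) (by grind)
  let g₂ := restrictEquiv (T := Fin d) (· ∉ A ∪ C) (· ∈ B) (· ∈ D) (by grind) (by grind)
    (by grind) (by grind)
  let e := (glueEquiv (A ∪ B)).symm.trans ((f₁.prodCongr g₁).trans (splitABCD _ _ _ _))
  refine ⟨ψ ∘ e, fun h => hψ0 ?_, Rigid.of_equiv e f₁ g₁ f₂ g₂ (fun x y => by simp [e])
    (fun x y => ?_) hψ⟩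
  · ext v
    simpa using congrFun h (e.symm v)
  · refine Prod.ext (funext fun i => ?_) (Prod.ext (funext fun i => ?_)
      (Prod.ext (funext fun i => ?_) (funext fun i => ?_)))
    all_goals
      have hi := i.2
      simp only [e, f₁, g₁, f₂, g₂, restrictEquiv, splitABCD, splitACBD, glueEquiv,
        Equiv.trans_apply, Equiv.symm_symm, Equiv.piEquivPiSubtypeProd_apply,
        Equiv.piEquivPiSubtypeProd_symm_apply, Equiv.prodCongr_apply, Equiv.coe_fn_mk, Prod.map,
        Equiv.prodAssoc_apply]
      grind

/-! ### From rigidity to unique determination -/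

theorem marginal_densityMatrix {N d : ℕ} (J : Finset (Fin N)) (ψ : QuditSpace N d) :
    marginal J (densityMatrix ψ) =
      cutMatrix (glueEquiv J) ψ * (cutMatrix (glueEquiv J) ψ).conjTranspose := rfl

/-- The marginal on the complement of `J` is the transpose of `Mᴴ M`. -/
theorem gram_eq_marginal_compl {N d : ℕ} (J : Finset (Fin N)) (ψ : QuditSpace N d)
    (w w' : {i // i ∉ J} → Fin d) :
    ((cutMatrix (glueEquiv J) ψ).conjTranspose * cutMatrix (glueEquiv J) ψ) w w' =
      marginal Jᶜ (densityMatrix ψ) (fun i => w' ⟨i, Finset.mem_compl.1 i.2⟩)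
        (fun i => w ⟨i, Finset.mem_compl.1 i.2⟩) := by
  have hmem : ∀ i, i ∈ J ↔ i ∉ Jᶜ := fun i => by simp
  let g : ({i // i ∈ J} → Fin d) ≃ ({i // i ∉ Jᶜ} → Fin d) :=
    (Equiv.subtypeEquivRight hmem).arrowCongr (Equiv.refl _)
  have hglue : ∀ x (z : {i // i ∉ J} → Fin d),
      glue Jᶜ (fun i => z ⟨i, Finset.mem_compl.1 i.2⟩) (g x) = glue J x z := by
    intro x z
    ext i
    by_cases hi : i ∈ J <;> simp [glue, hi, g, Equiv.arrowCongr]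
    rfl
  simp only [Matrix.mul_apply, Matrix.conjTranspose_apply, cutMatrix, Matrix.of_apply,
    glueEquiv_apply, marginal, densityMatrix]
  rw [← g.sum_comp]
  simp only [hglue]
  exact Finset.sum_congr rfl fun _ _ => mul_comm _ _

theorem cutCompatible_of_marginal_eq {N d : ℕ} {J : Finset (Fin N)} {ψ φ : QuditSpace N d}
    (h : marginal J (densityMatrix φ) = marginal J (densityMatrix ψ))
    (h' : marginal Jᶜ (densityMatrix φ) = marginal Jᶜ (densityMatrix ψ)) :
    CutCompatible (glueEquiv J) ψ φ :=
  .of_gram_eq _ (by rw [← marginal_densityMatrix, h, marginal_densityMatrix])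
    (by ext w w'; rw [gram_eq_marginal_compl, gram_eq_marginal_compl, h'])

theorem Rigid.isUDP {N d : ℕ} {J K : Finset (Fin N)} {F : Set (Finset (Fin N))}
    {ψ : PureState N d} (h : Rigid (glueEquiv J) (glueEquiv K) (ψ : QuditSpace N d))
    (hJ : J ∈ F) (hJ' : Jᶜ ∈ F) (hK : K ∈ F) (hK' : Kᶜ ∈ F) : IsUDP F ψ := by
  intro φ hφ
  obtain ⟨c, hc⟩ := h (φ : QuditSpace N d) (cutCompatible_of_marginal_eq (hφ J hJ) (hφ _ hJ'))
    (cutCompatible_of_marginal_eq (hφ K hK) (hφ _ hK'))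
  have hc' : (φ : QuditSpace N d) = c • (ψ : QuditSpace N d) := by
    ext x
    exact congrFun hc x
  refine ⟨c, ?_, hc'⟩
  have := congrArg norm hc'
  rwa [norm_smul, norm_eq_of_mem_sphere, norm_eq_of_mem_sphere, mul_one, eq_comm] at this

theorem ae_rigid_haarState {N d : ℕ} {J K : Finset (Fin N)}
    (h : ∃ ψ : (Fin N → Fin d) → ℂ, ψ ≠ 0 ∧ Rigid (glueEquiv J) (glueEquiv K) ψ) :
    ∀ᵐ (ψ : PureState N d) ∂(haarState N d),
      Rigid (glueEquiv J) (glueEquiv K) (ψ : QuditSpace N d) := by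
  obtain ⟨ψ₀, h0, hr⟩ := h
  refine Measure.ae_smul_measure (ae_toSphere_of_ae volume
    (p := fun ψ : QuditSpace N d => Rigid (glueEquiv J) (glueEquiv K) ψ) (fun r ψ _ hψ => ?_)
    (ae_rigid _ _ h0 hr)) _
  exact Rigid.of_smul (r : ℂ) hψ

theorem ae_isUDP {n d : ℕ} (hd : 1 ≤ d) {A B C D : Finset (Fin (2 * n))}
    (hA : A.Nonempty) (hB : B.Nonempty)
    (hAB : Disjoint A B) (hAC : Disjoint A C) (hAD : Disjoint A D) (hBC : Disjoint B C)
    (hBD : Disjoint B D) (hCD : Disjoint C D) (hU : A ∪ B ∪ C ∪ D = Finset.univ)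
    (cAB : (A ∪ B).card = n) (cAC : (A ∪ C).card = n) (cBD : (B ∪ D).card = n) :
    ∀ᵐ ψ ∂(haarState (2 * n) d), IsUDP {A ∪ B, C ∪ D, A ∪ C, B ∪ D} ψ := by
  rw [Finset.card_union_of_disjoint ‹_›] at cAB cAC cBD
  have compl : ∀ {S T : Finset (Fin (2 * n))}, Disjoint S T → S ∪ T = Finset.univ → Sᶜ = T :=
    fun h h' => (IsCompl.of_eq h.eq_bot h').compl_eq
  have c₁ : (A ∪ B)ᶜ = C ∪ D := compl (by simp [*]) (by rw [← hU]; grind)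
  have c₂ : (A ∪ C)ᶜ = B ∪ D := compl (by simp [*, disjoint_comm]) (by rw [← hU]; grind)
  have c₃ : (B ∪ D)ᶜ = A ∪ C := by rw [← c₂, compl_compl]
  rcases le_total B.card A.card with h | h
  · filter_upwards [ae_rigid_haarState (exists_rigid_glue hd hB hAB hAC hAD hBC hBD hCD hU
      (by lia) (by lia) h)] with ψ hψ
    exact hψ.isUDP (by simp) (by simp [c₁]) (by simp) (by simp [c₂])
  -- Exchanging `A` with `B` and `C` with `D` permutes the four sets.
  · filter_upwards [ae_rigid_haarState (exists_rigid_glue hd hA hAB.symm hBD hBC hAD hAC hCD.symm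
      (by rw [← hU]; grind) (by lia) (by lia) h)] with ψ hψ
    exact hψ.isUDP (by simp [Finset.union_comm B A]) (by simp [Finset.union_comm B A, c₁]) (by simp)
      (by simp [c₃])

theorem IsUDP.mono {N d : ℕ} {F F' : Set (Finset (Fin N))} {ψ : PureState N d} (hF : F ⊆ F')
    (h : IsUDP F ψ) : IsUDP F' ψ :=
  fun φ hφ => h φ fun J hJ => hφ J (hF hJ)

theorem exists_four_blocks {n : ℕ} (hn : 2 ≤ n) : ∃ A B C D : Finset (Fin (2 * n)),
    A.Nonempty ∧ B.Nonempty ∧ C.Nonempty ∧ D.Nonempty ∧ Disjoint A B ∧ Disjoint A C ∧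
      Disjoint A D ∧ Disjoint B C ∧ Disjoint B D ∧ Disjoint C D ∧
      A ∪ B ∪ C ∪ D = Finset.univ ∧ (A ∪ B).card = n ∧ (C ∪ D).card = n ∧ (A ∪ C).card = n ∧
      (B ∪ D).card = n := by
  obtain ⟨P, -, hP⟩ := Finset.exists_subset_card_eq (s := (Finset.univ : Finset (Fin (2 * n))))
    (n := n) (by simp; lia)
  have hPc : Pᶜ.card = n := by rw [Finset.card_compl, hP, Fintype.card_fin]; lia
  obtain ⟨A, hAP, hA⟩ := Finset.exists_subset_card_eq (s := P) (n := 1) (by lia)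
  obtain ⟨D, hDP, hD⟩ := Finset.exists_subset_card_eq (s := Pᶜ) (n := 1) (by lia)
  have hB : (P \ A).card = n - 1 := by rw [Finset.card_sdiff_of_subset hAP, hP, hA]
  have hC : (Pᶜ \ D).card = n - 1 := by rw [Finset.card_sdiff_of_subset hDP, hPc, hD]
  have hPP : Disjoint P Pᶜ := disjoint_compl_right
  have d1 : Disjoint A (P \ A) := Finset.disjoint_sdiff
  have d2 : Disjoint A (Pᶜ \ D) := hPP.mono hAP Finset.sdiff_subset
  have d3 : Disjoint A D := hPP.mono hAP hDP
  have d4 : Disjoint (P \ A) (Pᶜ \ D) := hPP.mono Finset.sdiff_subset Finset.sdiff_subset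
  have d5 : Disjoint (P \ A) D := hPP.mono Finset.sdiff_subset hDP
  have d6 : Disjoint (Pᶜ \ D) D := Finset.sdiff_disjoint
  refine ⟨A, P \ A, Pᶜ \ D, D, ?_, ?_, ?_, ?_, d1, d2, d3, d4, d5, d6, ?_, ?_, ?_, ?_, ?_⟩
  · rw [← Finset.card_pos]; lia
  · rw [← Finset.card_pos]; lia
  · rw [← Finset.card_pos]; lia
  · rw [← Finset.card_pos]; lia
  · rw [Finset.union_sdiff_of_subset hAP, Finset.union_assoc, Finset.sdiff_union_of_subset hDP,
      Finset.union_compl]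
  all_goals
    rw [Finset.card_union_of_disjoint ‹_›]
    lia

end

theorem theorem1 (n d : ℕ) (hn : 2 ≤ n) (hd : 1 ≤ d) :
    ∀ᵐ ψ ∂(haarState (2 * n) d),
      IsUDP {J : Finset (Fin (2 * n)) | J.card = n} ψ ∧
      ∀ A B C D : Finset (Fin (2 * n)),
        A.Nonempty → B.Nonempty → C.Nonempty → D.Nonempty →
        Disjoint A B → Disjoint A C → Disjoint A D →
        Disjoint B C → Disjoint B D → Disjoint C D →
        A ∪ B ∪ C ∪ D = Finset.univ →
        (A ∪ B).card = n → (C ∪ D).card = n → (A ∪ C).card = n → (B ∪ D).card = n →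
        IsUDP {A ∪ B, C ∪ D, A ∪ C, B ∪ D} ψ := by
  refine Filter.Eventually.mono (p := fun ψ : PureState (2 * n) d =>
    ∀ A B C D : Finset (Fin (2 * n)),
        A.Nonempty → B.Nonempty → C.Nonempty → D.Nonempty →
        Disjoint A B → Disjoint A C → Disjoint A D →
        Disjoint B C → Disjoint B D → Disjoint C D →
        A ∪ B ∪ C ∪ D = Finset.univ →
        (A ∪ B).card = n → (C ∪ D).card = n → (A ∪ C).card = n → (B ∪ D).card = n →
        IsUDP {A ∪ B, C ∪ D, A ∪ C, B ∪ D} ψ) ?_ fun ψ hψ => ⟨?_, hψ⟩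
  · simp only [ae_all_iff, Filter.eventually_imp_distrib_left]
    intro A B C D hA hB _ _ hAB hAC hAD hBC hBD hCD hU cAB _ cAC cBD
    exact ae_isUDP hd hA hB hAB hAC hAD hBC hBD hCD hU cAB cAC cBD
  · obtain ⟨A, B, C, D, hA, hB, hC, hD, hAB, hAC, hAD, hBC, hBD, hCD, hU, cAB, cCD, cAC, cBD⟩ :=
      exists_four_blocks hn
    refine (hψ A B C D hA hB hC hD hAB hAC hAD hBC hBD hCD hU cAB cCD cAC cBD).mono ?_
    rintro J (rfl | rfl | rfl | rfl) <;> assumption
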